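/- There is a universal constant $K>0$ such that the following holds for every finite set $\Omega$, every probability measure $\mu$ on $(\Omega,\mathcal P(\Omega))$ with $p_{\min}=\min_{j\in\Omega}\mu(\{j\})>0$, every $n\in\mathbb N$ and every function $f:\Omega^n\to\mathbb C$. Let $\mu^n$ be the product measure on $\Omega^n$; for $g:\Omega^n\to\mathbb C$ and $q\in[1,\infty)$ let $\|g\|_q=\bigl(\int_{\Omega^n}|g|^q\,d\mu^n\bigr)^{1/q}$, let $\mathrm{Var}(f)=\int_{\Omega^n}\bigl|f-\int_{\Omega^n} f\,d\mu^n\bigr|^2\,d\mu^n$, and for $i=1,\dots,n$ let $$\Delta_i f(x_1,\dots,x_n)=f(x_1,\dots,x_n)-\int_\Omega f(x_1,\dots,x_{i-1},\xi,x_{i+1},\dots,x_n)\,\mu(d\xi).$$ Then $$\mathrm{Var}(f)\le K\log(1/p_{\min})\sum_{i=1}^n\frac{\|\Delta_i f\|_2^2}{\log\bigl(e\|\Delta_i f\|_2/\|\Delta_i f\|_1\bigr)},$$ where a summand with $\Delta_i f=0$ is read as $0$. -/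

import Mathlib

open MeasureTheory

noncomputable section

namespace Influence

/-- The smallest mass `p_min = min_j μ({j})` of a point of `Ω`. It is used for a finite nonempty
`Ω`, where the infimum is a minimum. -/
def pMin {Ω : Type*} [MeasurableSpace Ω] (μ : Measure Ω) : ℝ :=
  ⨅ j : Ω, μ.real {j}

/-- The product measure `μ^n` on `Ω^n`. -/
abbrev power {Ω : Type*} [MeasurableSpace Ω] (μ : Measure Ω) (n : ℕ) : Measure (Fin n → Ω) :=
  Measure.pi fun _ : Fin n => μ

/-- The variance `∫ |f - ∫ f dν|² dν` of a complex valued function `f`. -/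
def complexVariance {X : Type*} [MeasurableSpace X] (ν : Measure X) (f : X → ℂ) : ℝ :=
  ∫ x, ‖f x - ∫ y, f y ∂ν‖ ^ 2 ∂ν

/-- The `L^q` norm `(∫ |f|^q dν)^(1/q)`, for real `q ≥ 1`. -/
def lqNorm {X : Type*} [MeasurableSpace X] (ν : Measure X) (q : ℝ) (f : X → ℂ) : ℝ :=
  (∫ x, ‖f x‖ ^ q ∂ν) ^ (1 / q)

/-- The influence of the `i`th variable on `f`:
`Δ_i f (x) = f(x) - ∫ f(x_1, …, x_{i-1}, ξ, x_{i+1}, …, x_n) μ(dξ)`. -/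
def delta {Ω : Type*} [MeasurableSpace Ω] (μ : Measure Ω) {n : ℕ} (i : Fin n)
    (f : (Fin n → Ω) → ℂ) : (Fin n → Ω) → ℂ :=
  fun x => f x - ∫ ξ, f (Function.update x i ξ) ∂μ

end Influence

end

open scoped ComplexConjugate

namespace Influence

/-! Expand `f` in the tensor power of an orthonormal basis of `L²(μ)` containing the constant `1` at
index `o`. Then `Δ_i` keeps exactly the coefficients with `α i ≠ o`, so the variance is the sum over
`i` of `∑ α, ‖c α‖² / level o α` taken over the coefficients of `Δ_i f` (`sum_div_level`). For a
single `g = Δ_i f`, damping by `p ^ level` is a contraction `L² → L⁴` (`hypercontractive`). By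
duality and interpolation, `∑ p^(2 level) ‖c α‖² ≤ ‖g‖₁ ‖g‖₂` (`sum_damping_sq_le`): a small `L¹`
norm leaves little mass on low levels, while on high levels `1 / level` is small.
`inv_le_add_pow_mul_sqrt` balances the two. -/

/-- The real functions `φ a` form an orthonormal basis of `L²` of the weight `w`. -/
structure IsWeightedBasis {X ι : Type*} [Fintype X] [Fintype ι] [DecidableEq X] [DecidableEq ι]
    (w : X → ℝ) (φ : ι → X → ℝ) : Prop where
  orthonormal : ∀ a b, ∑ x, w x * (φ a x * φ b x) = if a = b then 1 else 0
  complete : ∀ x y, ∑ a, φ a x * φ a y * w y = if x = y then 1 else 0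

/-- The linear combination of the functions `φ a` with coefficients `c a`. -/
def synth {X ι : Type*} [Fintype ι] (φ : ι → X → ℝ) (c : ι → ℂ) (x : X) : ℂ :=
  ∑ a, c a * (φ a x : ℂ)

/-- The tensor power of a function of one variable, or of a weight. -/
def tensor {κ X : Type*} [Fintype κ] (u : κ → X → ℝ) (x : κ → X) : ℝ :=
  ∏ i, u i (x i)

/-! ### Parseval identities for weighted and tensor bases -/

section Basis

variable {X ι : Type*} [Fintype X] [Fintype ι] [DecidableEq X] [DecidableEq ι]
  {w : X → ℝ} {φ : ι → X → ℝ}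

theorem IsWeightedBasis.tensorPower {κ : Type*} [Fintype κ] [DecidableEq κ]
    (h : IsWeightedBasis w φ) :
    IsWeightedBasis (tensor fun _ : κ => w) (fun α : κ → ι => tensor fun i => φ (α i)) where
  orthonormal a b := by
    simp only [tensor, ← Finset.prod_mul_distrib]
    rw [← Fintype.prod_sum fun i x => w x * (φ (a i) x * φ (b i) x)]
    simp only [h.orthonormal, Finset.prod_ite_zero, Finset.prod_const_one, funext_iff,
      Finset.mem_univ, true_imp_iff]
  complete x y := by
    simp only [tensor, ← Finset.prod_mul_distrib]
    rw [← Fintype.prod_sum fun i a => φ a (x i) * φ a (y i) * w (y i)]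
    simp only [h.complete, Finset.prod_ite_zero, Finset.prod_const_one, funext_iff,
      Finset.mem_univ, true_imp_iff]

theorem IsWeightedBasis.sum_conj_synth_mul_synth (h : IsWeightedBasis w φ) (c d : ι → ℂ) :
    ∑ x, (w x : ℂ) * (conj (synth φ c x) * synth φ d x) = ∑ a, conj (c a) * d a := by
  have key (x : X) : (w x : ℂ) * (conj (synth φ c x) * synth φ d x) =
      ∑ a, ∑ b, conj (c a) * d b * ((w x * (φ a x * φ b x) : ℝ) : ℂ) := by
    simp only [synth, map_sum, map_mul, Complex.conj_ofReal]
    rw [Finset.sum_mul_sum]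
    simp only [Finset.mul_sum]
    refine Finset.sum_congr rfl fun a _ => Finset.sum_congr rfl fun b _ => ?_
    push_cast
    ring
  simp only [key]
  rw [Finset.sum_comm]
  refine Finset.sum_congr rfl fun a _ => ?_
  rw [Finset.sum_comm]
  have (b : ι) : ∑ x, conj (c a) * d b * ((w x * (φ a x * φ b x) : ℝ) : ℂ) =
      if a = b then conj (c a) * d b else 0 := by
    rw [← Finset.mul_sum, ← Complex.ofReal_sum, h.orthonormal]
    split_ifs <;> simp
  simp only [this]
  simp

theorem IsWeightedBasis.sum_norm_sq_synth (h : IsWeightedBasis w φ) (c : ι → ℂ) :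
    ∑ x, w x * ‖synth φ c x‖ ^ 2 = ∑ a, ‖c a‖ ^ 2 := by
  have := h.sum_conj_synth_mul_synth c c
  simp only [Complex.conj_mul'] at this
  exact_mod_cast this

theorem IsWeightedBasis.sum_synth (h : IsWeightedBasis w φ) {o : ι} (ho : ∀ x, φ o x = 1)
    (c : ι → ℂ) : ∑ x, (w x : ℂ) * synth φ c x = c o := by
  have := h.sum_conj_synth_mul_synth (Pi.single o 1) c
  have e (x : X) : synth φ (Pi.single o 1) x = 1 := by
    simp [synth, Pi.single_apply, ho]
  simpa [e, Pi.single_apply] using this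

theorem IsWeightedBasis.sum_weight (h : IsWeightedBasis w φ) {o : ι} (ho : ∀ x, φ o x = 1) :
    ∑ x, w x = 1 := by
  simpa [ho] using h.orthonormal o o

theorem IsWeightedBasis.exists_synth (h : IsWeightedBasis w φ) (f : X → ℂ) :
    ∃ c, f = synth φ c := by
  refine ⟨fun a => ∑ y, (φ a y * w y : ℝ) * f y, funext fun x => ?_⟩
  simp only [synth, Finset.sum_mul]
  rw [Finset.sum_comm]
  have (y : X) : ∑ a, ((φ a y * w y : ℝ) : ℂ) * f y * (φ a x : ℂ) =
      f y * ((∑ a, φ a x * φ a y * w y : ℝ) : ℂ) := by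
    rw [Complex.ofReal_sum, Finset.mul_sum]
    refine Finset.sum_congr rfl fun a _ => ?_
    push_cast
    ring
  simp_rw [this, h.complete]
  rw [Finset.sum_eq_single x (fun y _ hy => by simp [hy.symm]) (by simp)]
  simp

/-! ### One-variable hypercontractivity -/

/-- The term linear in `h` is kept exact because it averages to zero when `h` has mean zero. -/
theorem norm_add_pow_four_le (a h : ℂ) {ρ : ℝ} (hρ : 0 ≤ ρ) :
    ‖a + ρ * h‖ ^ 4 ≤ ‖a‖ ^ 4 + 4 * ρ * ‖a‖ ^ 2 * (conj a * h).re
      + 8 * ρ ^ 2 * ‖a‖ ^ 2 * ‖h‖ ^ 2 + 3 * ρ ^ 4 * ‖h‖ ^ 4 := by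
  have e : ‖a + ρ * h‖ ^ 2 = ‖a‖ ^ 2 + 2 * ρ * (conj a * h).re + ρ ^ 2 * ‖h‖ ^ 2 := by
    simp only [Complex.sq_norm, Complex.normSq_apply, Complex.add_re, Complex.add_im,
      Complex.mul_re, Complex.mul_im, Complex.conj_re, Complex.conj_im, Complex.ofReal_re,
      Complex.ofReal_im]
    ring
  have hr : |(conj a * h).re| ≤ ‖a‖ * ‖h‖ := by
    simpa using Complex.abs_re_le_norm (conj a * h)
  have hr2 : (conj a * h).re ^ 2 ≤ ‖a‖ ^ 2 * ‖h‖ ^ 2 := by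
    rw [← mul_pow]
    exact sq_le_sq' (neg_le_of_abs_le hr) (le_of_abs_le hr)
  have hr1 := le_of_abs_le hr
  set r := (conj a * h).re
  have h4 : ‖a + ρ * h‖ ^ 4 = (‖a + ρ * h‖ ^ 2) ^ 2 := by ring
  rw [h4, e]
  have t1 : 4 * ρ ^ 2 * r ^ 2 ≤ 4 * ρ ^ 2 * (‖a‖ ^ 2 * ‖h‖ ^ 2) := by gcongr
  have t2 : 4 * ρ ^ 3 * ‖h‖ ^ 2 * r ≤ 4 * ρ ^ 3 * ‖h‖ ^ 2 * (‖a‖ * ‖h‖) := by gcongr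
  have t3 : 0 ≤ 2 * ρ ^ 2 * ‖h‖ ^ 2 * (‖a‖ - ρ * ‖h‖) ^ 2 := by positivity
  nlinarith only [t1, t2, t3]

/-- A crude hypercontractive estimate for one variable: damping all but the constant component by
a lower bound `p` of the weights maps `L²` to `L⁴` with norm at most one. -/
theorem IsWeightedBasis.hypercontractive_single (h : IsWeightedBasis w φ) {o : ι}
    (ho : ∀ x, φ o x = 1) {p : ℝ} (hp : 0 < p) (hp2 : p ≤ 1 / 2) (hw : ∀ x, p ≤ w x)
    (c : ι → ℂ) :
    ∑ x, w x * ‖synth φ (fun a => ((if a = o then 1 else p : ℝ) : ℂ) * c a) x‖ ^ 4 ≤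
      (∑ a, ‖c a‖ ^ 2) ^ 2 := by
  set d : ι → ℂ := fun a => if a = o then 0 else c a with hd
  have hsyn (x : X) : synth φ (fun a => ((if a = o then 1 else p : ℝ) : ℂ) * c a) x =
      c o + p * synth φ d x := by
    have : c o = ∑ a, if a = o then c a * (φ a x : ℂ) else 0 := by simp [ho]
    rw [this]
    simp only [synth, Finset.mul_sum, ← Finset.sum_add_distrib]
    refine Finset.sum_congr rfl fun a _ => ?_
    by_cases hao : a = o <;> simp [hd, hao, mul_assoc]
  have hmean : ∑ x, (w x : ℂ) * synth φ d x = 0 := by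
    rw [h.sum_synth ho]; simp [hd]
  have hsplit : ∑ a, ‖c a‖ ^ 2 = ‖c o‖ ^ 2 + ∑ a, ‖d a‖ ^ 2 := by
    have : ‖c o‖ ^ 2 = ∑ a, if a = o then ‖c a‖ ^ 2 else 0 := by simp
    rw [this, ← Finset.sum_add_distrib]
    refine Finset.sum_congr rfl fun a _ => ?_
    by_cases hao : a = o <;> simp [hd, hao]
  have hvar := h.sum_norm_sq_synth d
  set σ := ∑ a, ‖d a‖ ^ 2
  have hσ : 0 ≤ σ := Finset.sum_nonneg fun _ _ => by positivity
  -- Each point has mass at least `p`, so the variance controls the supremum; this turns the fourth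
  -- moment into a second moment at the price of `1 / p`.
  have hsup (x : X) : p * ‖synth φ d x‖ ^ 2 ≤ σ := by
    rw [← hvar]
    refine le_trans (mul_le_mul_of_nonneg_right (hw x) (by positivity)) ?_
    exact Finset.single_le_sum (f := fun x => w x * ‖synth φ d x‖ ^ 2)
      (fun y _ => mul_nonneg (hp.le.trans (hw y)) (by positivity)) (Finset.mem_univ x)
  have hre : ∑ x, w x * (conj (c o) * synth φ d x).re = 0 := by
    have : ∑ x, w x * (conj (c o) * synth φ d x).re =
        (conj (c o) * ∑ x, (w x : ℂ) * synth φ d x).re := by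
      rw [Finset.mul_sum, Complex.re_sum]
      refine Finset.sum_congr rfl fun x _ => ?_
      rw [← Complex.re_ofReal_mul]
      congr 1
      ring
    rw [this, hmean]; simp
  calc _ ≤ ∑ x, (‖c o‖ ^ 4 * w x + 4 * p * ‖c o‖ ^ 2 * (w x * (conj (c o) * synth φ d x).re)
        + (8 * p ^ 2 * ‖c o‖ ^ 2 + 3 * p ^ 3 * σ) * (w x * ‖synth φ d x‖ ^ 2)) := by
        refine Finset.sum_le_sum fun x _ => ?_
        rw [hsyn]
        have h1 := mul_le_mul_of_nonneg_left (norm_add_pow_four_le (c o) (synth φ d x) hp.le)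
          (hp.le.trans (hw x))
        have h2 := mul_le_mul_of_nonneg_left (hsup x)
          (show 0 ≤ w x * (3 * p ^ 3 * ‖synth φ d x‖ ^ 2) from
            mul_nonneg (hp.le.trans (hw x)) (by positivity))
        nlinarith only [h1, h2]
    _ = ‖c o‖ ^ 4 + (8 * p ^ 2 * ‖c o‖ ^ 2 + 3 * p ^ 3 * σ) * σ := by
        rw [Finset.sum_add_distrib, Finset.sum_add_distrib, ← Finset.mul_sum, ← Finset.mul_sum,
          ← Finset.mul_sum, hre, hvar, h.sum_weight ho]
        ring
    _ ≤ _ := by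
        rw [hsplit]
        -- Now `8 p² ≤ 2`, the cross coefficient of the square, and `3 p³ ≤ 3/8 ≤ 1`.
        have p2 : p ^ 2 ≤ 1 / 4 := by nlinarith
        have p3 : p ^ 3 ≤ 1 / 8 := by nlinarith
        have t1 := mul_le_mul_of_nonneg_right p2 (show 0 ≤ 8 * ‖c o‖ ^ 2 * σ by positivity)
        have t2 := mul_le_mul_of_nonneg_right p3 (show 0 ≤ 3 * σ ^ 2 by positivity)
        nlinarith only [t1, t2, sq_nonneg σ]

end Basis

/-! ### Tensorisation and duality -/

/-- The factor `p ^ #{i | α i ≠ o}`. -/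
def damping {κ ι : Type*} [Fintype κ] [DecidableEq ι] (o : ι) (p : ℝ) (α : κ → ι) : ℝ :=
  ∏ i, if α i = o then 1 else p

/-- Minkowski's inequality in `L²(w)`, by Cauchy–Schwarz on each cross term. The induction on `n`
applies it to `u a = ‖G a‖²`. -/
theorem sum_mul_sum_sq_le {X ι : Type*} [Fintype X] [Fintype ι] {w : X → ℝ} (hw : ∀ x, 0 ≤ w x)
    (u : ι → X → ℝ) {A : ι → ℝ} (hA : ∀ a, 0 ≤ A a)
    (h : ∀ a, ∑ x, w x * u a x ^ 2 ≤ A a ^ 2) :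
    ∑ x, w x * (∑ a, u a x) ^ 2 ≤ (∑ a, A a) ^ 2 := by
  have hab (a b : ι) : ∑ x, w x * (u a x * u b x) ≤ A a * A b := by
    refine abs_le_of_sq_le_sq' ?_ (mul_nonneg (hA a) (hA b)) |>.2
    calc _ = (∑ x, (√(w x) * u a x) * (√(w x) * u b x)) ^ 2 := by
          congr 1
          refine Finset.sum_congr rfl fun x _ => ?_
          linear_combination (-u a x * u b x) * Real.mul_self_sqrt (hw x)
      _ ≤ _ := Finset.sum_mul_sq_le_sq_mul_sq _ _ _
      _ ≤ A a ^ 2 * A b ^ 2 := by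
          simp only [mul_pow, Real.sq_sqrt (hw _)]
          gcongr
          · exact Finset.sum_nonneg fun x _ => mul_nonneg (hw x) (sq_nonneg _)
          · exact h a
          · exact h b
      _ = _ := by ring
  calc _ = ∑ a, ∑ b, ∑ x, w x * (u a x * u b x) := by
        simp_rw [sq (∑ a, u a _), Finset.sum_mul_sum, Finset.mul_sum]
        rw [Finset.sum_comm]
        exact Finset.sum_congr rfl fun a _ => Finset.sum_comm
    _ ≤ ∑ a, ∑ b, A a * A b := Finset.sum_le_sum fun a _ => Finset.sum_le_sum fun b _ => hab a b
    _ = _ := by rw [sq, Finset.sum_mul_sum]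

theorem sum_fin_succ {Y M : Type*} [Fintype Y] [AddCommMonoid M] {n : ℕ}
    (F : (Fin (n + 1) → Y) → M) :
    ∑ x, F x = ∑ a, ∑ y : Fin n → Y, F (Fin.cons a y) := by
  rw [← Fintype.sum_prod_type']
  exact (Fintype.sum_equiv (Fin.consEquiv fun _ => Y) _ _ fun _ => rfl).symm

section Product

variable {X ι : Type*} [Fintype X] [Fintype ι] [DecidableEq X] [DecidableEq ι]
  {w : X → ℝ} {φ : ι → X → ℝ}

theorem IsWeightedBasis.hypercontractive (h : IsWeightedBasis w φ) {o : ι}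
    (ho : ∀ x, φ o x = 1) {p : ℝ} (hp : 0 < p) (hp2 : p ≤ 1 / 2) (hw : ∀ x, p ≤ w x)
    {n : ℕ} (c : (Fin n → ι) → ℂ) :
    ∑ x, tensor (fun _ => w) x *
        ‖synth (fun α : Fin n → ι => tensor fun i => φ (α i)) (fun α => damping o p α * c α) x‖ ^ 4
      ≤ (∑ α, ‖c α‖ ^ 2) ^ 2 := by
  induction n with
  | zero =>
    simp [synth, tensor, damping, ← pow_mul]
  | succ n ih =>
    have hw0 (x : X) : 0 ≤ w x := hp.le.trans (hw x)
    set G : ι → (Fin n → X) → ℂ := fun a =>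
      synth (fun α : Fin n → ι => tensor fun i => φ (α i))
        (fun α => damping o p α * c (Fin.cons a α)) with hG
    have hsyn (x : X) (y : Fin n → X) :
        synth (fun α : Fin (n + 1) → ι => tensor fun i => φ (α i))
          (fun α => damping o p α * c α) (Fin.cons x y) =
        synth φ (fun a => ((if a = o then 1 else p : ℝ) : ℂ) * G a y) x := by
      simp only [synth, hG, sum_fin_succ, tensor, damping, Fin.prod_univ_succ, Fin.cons_zero,
        Fin.cons_succ, Finset.mul_sum, Finset.sum_mul]
      refine Finset.sum_congr rfl fun a _ => Finset.sum_congr rfl fun β _ => ?_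
      push_cast
      ring
    have hten (x : X) (y : Fin n → X) :
        tensor (fun _ : Fin (n + 1) => w) (Fin.cons x y : Fin (n + 1) → X) =
          w x * tensor (fun _ : Fin n => w) y := by
      simp [tensor, Fin.prod_univ_succ]
    rw [sum_fin_succ, Finset.sum_comm]
    -- The one-variable estimate is applied in the first coordinate with `y` frozen, then Minkowski
    -- and the induction hypothesis in `y`.
    calc _ = ∑ y, tensor (fun _ : Fin n => w) y *
          ∑ x, w x * ‖synth φ (fun a => ((if a = o then 1 else p : ℝ) : ℂ) * G a y) x‖ ^ 4 := by
          simp only [hsyn, hten, Finset.mul_sum]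
          refine Finset.sum_congr rfl fun y _ => Finset.sum_congr rfl fun x _ => ?_
          ring
      _ ≤ ∑ y, tensor (fun _ : Fin n => w) y * (∑ a, ‖G a y‖ ^ 2) ^ 2 := by
          gcongr with y
          · exact Finset.prod_nonneg fun i _ => hw0 _
          · exact h.hypercontractive_single ho hp hp2 hw _
      _ ≤ (∑ a, ∑ β, ‖c (Fin.cons a β)‖ ^ 2) ^ 2 := by
          refine sum_mul_sum_sq_le (fun y => Finset.prod_nonneg fun i _ => hw0 _) _
            (fun a => Finset.sum_nonneg fun _ _ => by positivity) fun a => ?_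
          refine le_of_eq_of_le (Finset.sum_congr rfl fun y _ => ?_) (ih fun β => c (Fin.cons a β))
          rw [← pow_mul]
          rfl
      _ = _ := by rw [sum_fin_succ]

/-- The dual form of the hypercontractive estimate, after an interpolation between `L¹` and
`L²`. -/
theorem IsWeightedBasis.sum_damping_sq_le (h : IsWeightedBasis w φ) {o : ι}
    (ho : ∀ x, φ o x = 1) {p : ℝ} (hp : 0 < p) (hp2 : p ≤ 1 / 2) (hw : ∀ x, p ≤ w x)
    {n : ℕ} (c : (Fin n → ι) → ℂ) (g : (Fin n → X) → ℂ)
    (hg : g = synth (fun α : Fin n → ι => tensor fun i => φ (α i)) c) :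
    (∑ α, damping o p α ^ 2 * ‖c α‖ ^ 2) ^ 2 ≤
      (∑ x, tensor (fun _ => w) x * ‖g x‖) ^ 2 * ∑ x, tensor (fun _ => w) x * ‖g x‖ ^ 2 := by
  set W := tensor fun _ : Fin n => w
  have hW (x) : 0 ≤ W x := Finset.prod_nonneg fun i _ => hp.le.trans (hw _)
  set u := synth (fun α : Fin n → ι => tensor fun i => φ (α i))
    (fun α => damping o p α * (damping o p α * c α)) with hu
  set B := ∑ α, damping o p α ^ 2 * ‖c α‖ ^ 2 with hB
  have hB0 : 0 ≤ B := Finset.sum_nonneg fun _ _ => by positivity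
  have h4 : ∑ x, W x * ‖u x‖ ^ 4 ≤ B ^ 2 := by
    refine (h.hypercontractive ho hp hp2 hw _).trans_eq ?_
    simp [hB, mul_pow]
  -- `u` is `g` damped twice, so `B` is the inner product of `g` and `u`. Two Cauchy–Schwarz steps
  -- then replace Hölder with exponents `4/3` and `4`.
  have h1 : B ≤ ∑ x, W x * ‖g x‖ * ‖u x‖ := by
    have e : (B : ℂ) = ∑ x, (W x : ℂ) * (conj (g x) * u x) := by
      rw [hg, h.tensorPower.sum_conj_synth_mul_synth, hB]
      push_cast
      refine Finset.sum_congr rfl fun α _ => ?_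
      rw [← Complex.conj_mul']
      ring
    calc B = ‖(B : ℂ)‖ := by simp [abs_of_nonneg hB0]
      _ ≤ _ := by
        rw [e]
        refine (norm_sum_le _ _).trans_eq (Finset.sum_congr rfl fun x _ => ?_)
        simp [abs_of_nonneg (hW x), mul_assoc]
  set A1 := ∑ x, W x * ‖g x‖
  set A2 := ∑ x, W x * ‖g x‖ ^ 2
  have hA1 : 0 ≤ A1 := Finset.sum_nonneg fun x _ => mul_nonneg (hW x) (norm_nonneg _)
  have hA2 : 0 ≤ A2 := Finset.sum_nonneg fun x _ => mul_nonneg (hW x) (by positivity)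
  have h2 : B ^ 2 ≤ A1 * ∑ x, W x * ‖g x‖ * ‖u x‖ ^ 2 := by
    calc B ^ 2 ≤ (∑ x, W x * ‖g x‖ * ‖u x‖) ^ 2 := by gcongr
      _ = (∑ x, √(W x * ‖g x‖) * (√(W x * ‖g x‖) * ‖u x‖)) ^ 2 := by
          congr 1
          refine Finset.sum_congr rfl fun x _ => ?_
          rw [← mul_assoc, Real.mul_self_sqrt (mul_nonneg (hW x) (norm_nonneg _))]
      _ ≤ _ := Finset.sum_mul_sq_le_sq_mul_sq _ _ _
      _ = _ := by
          simp only [mul_pow, Real.sq_sqrt (mul_nonneg (hW _) (norm_nonneg _))]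
          rfl
  have h3 : (∑ x, W x * ‖g x‖ * ‖u x‖ ^ 2) ^ 2 ≤ A2 * ∑ x, W x * ‖u x‖ ^ 4 := by
    calc _ = (∑ x, √(W x) * ‖g x‖ * (√(W x) * ‖u x‖ ^ 2)) ^ 2 := by
          congr 1
          refine Finset.sum_congr rfl fun x _ => ?_
          linear_combination (-‖g x‖ * ‖u x‖ ^ 2) * Real.mul_self_sqrt (hW x)
      _ ≤ _ := Finset.sum_mul_sq_le_sq_mul_sq _ _ _
      _ = _ := by
          simp only [mul_pow, Real.sq_sqrt (hW _), ← pow_mul]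
          rfl
  rcases hB0.eq_or_lt with h0 | h0
  · rw [← h0, zero_pow two_ne_zero]; positivity
  have h5 : (B ^ 2) * (B ^ 2) ≤ (A1 ^ 2 * A2) * B ^ 2 := by
    calc (B ^ 2) * (B ^ 2) = (B ^ 2) ^ 2 := by ring
      _ ≤ (A1 * ∑ x, W x * ‖g x‖ * ‖u x‖ ^ 2) ^ 2 := by gcongr
      _ = A1 ^ 2 * (∑ x, W x * ‖g x‖ * ‖u x‖ ^ 2) ^ 2 := by ring
      _ ≤ A1 ^ 2 * (A2 * B ^ 2) := by
          gcongr
          exact h3.trans (by gcongr)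
      _ = _ := by ring
  exact le_of_mul_le_mul_right h5 (by positivity)

end Product

/-! ### A basis containing the constant function -/

/-- The vector `√w` is a unit vector; extend it to a Euclidean orthonormal basis and divide by `√w`.
-/
theorem exists_isWeightedBasis {X : Type*} [Fintype X] [DecidableEq X] {w : X → ℝ}
    (hw : ∀ x, 0 < w x) (hsum : ∑ x, w x = 1) (o : X) :
    ∃ φ : X → X → ℝ, IsWeightedBasis w φ ∧ ∀ x, φ o x = 1 := by
  set v : X → EuclideanSpace ℝ X := fun _ => WithLp.toLp 2 fun x => √(w x)
  have hv : Orthonormal ℝ (({o} : Set X).domRestrict v) := by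
    refine ⟨fun i => ?_, fun i j hij => (hij (Subsingleton.elim i j)).elim⟩
    simp [v, EuclideanSpace.norm_eq, Real.sq_sqrt (hw _).le, hsum, Set.domRestrict]
  obtain ⟨b, hb⟩ := hv.exists_orthonormalBasis_extension_of_card_eq (by simp)
  have hs (x : X) : √(w x) ≠ 0 := (Real.sqrt_pos.2 (hw x)).ne'
  refine ⟨fun a x => b a x / √(w x), ⟨fun a a' => ?_, fun x y => ?_⟩, fun x => ?_⟩
  · rw [← b.inner_eq_ite a a', PiLp.inner_apply]
    refine Finset.sum_congr rfl fun x _ => ?_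
    have := Real.mul_self_sqrt (hw x).le
    have h0 := hs x
    simp only [RCLike.inner_apply, conj_trivial]
    field_simp
    rw [sq, this]
    ring
  · have h := b.sum_inner_mul_inner (EuclideanSpace.single x 1) (EuclideanSpace.single y 1)
    simp only [EuclideanSpace.inner_single_left, EuclideanSpace.inner_single_right, map_one,
      one_mul, conj_trivial] at h
    have e (a : X) : b a x / √(w x) * (b a y / √(w y)) * w y =
        √(w y) / √(w x) * (b a x * b a y) := by
      have := Real.mul_self_sqrt (hw y).le
      have h0 := hs x
      have h1 := hs y
      field_simp
      rw [sq, this]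
    simp only [e, ← Finset.mul_sum, h]
    by_cases hxy : x = y
    · subst hxy; simp [hs]
    · simp [hxy]
  · simp only [hb o rfl]
    exact div_self (hs x)

/-! ### Low levels against high levels -/

/-- The number of coordinates in which `α` differs from `o`. -/
def level {κ ι : Type*} [Fintype κ] [DecidableEq ι] (o : ι) (α : κ → ι) : ℕ :=
  (Finset.univ.filter fun i => α i ≠ o).card

theorem damping_eq_pow_level {κ ι : Type*} [Fintype κ] [DecidableEq ι] (o : ι) (p : ℝ)
    (α : κ → ι) : damping o p α = p ^ level o α := by
  simp [damping, level, Finset.prod_ite]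

/-- If `log r ≤ 4 k log (1/p)`, the first term suffices; otherwise `p^(2k) √r > 1` and the second
does. For `k = 0` the inverse is `0` by convention. -/
theorem inv_le_add_pow_mul_sqrt {p r : ℝ} (hp : 0 < p) (hp2 : p ≤ 1 / 2) (hr : 1 ≤ r) {k : ℕ} :
    (k : ℝ)⁻¹ ≤ (1 + 4 * Real.log (1 / p)) / (1 + Real.log r) + (p ^ k) ^ 2 * √r := by
  have hr0 : 0 < r := one_pos.trans_le hr
  have hlr : 0 ≤ Real.log r := Real.log_nonneg hr
  have hL : 0 ≤ Real.log (1 / p) := Real.log_nonneg (by rw [le_div_iff₀ hp]; linarith)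
  have hfst : 0 ≤ (1 + 4 * Real.log (1 / p)) / (1 + Real.log r) := by positivity
  rcases k.eq_zero_or_pos with rfl | hk
  · simpa using add_nonneg hfst (Real.sqrt_nonneg r)
  have hk1 : (1 : ℝ) ≤ k := by exact_mod_cast hk
  rcases le_or_gt (Real.log r) (4 * k * Real.log (1 / p)) with hle | hlt
  · refine le_add_of_le_of_nonneg ?_ (by positivity)
    rw [inv_le_comm₀ (by positivity) (by positivity), inv_div, div_le_iff₀ (by positivity)]
    nlinarith
  · refine le_add_of_nonneg_of_le hfst ?_
    refine (inv_le_one_of_one_le₀ hk1).trans ?_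
    rw [← Real.log_nonneg_iff (by positivity), Real.log_mul (by positivity) (by positivity),
      Real.log_pow, Real.log_pow, Real.log_sqrt hr0.le]
    rw [one_div, Real.log_inv] at hlt
    push_cast
    linarith

theorem sum_div_le_of_sum_pow_mul_le {ι : Type*} [Fintype ι] {a : ι → ℝ} (ha : ∀ i, 0 ≤ a i)
    (k : ι → ℕ) {p N₁ N₂ : ℝ} (hp : 0 < p) (hp2 : p ≤ 1 / 2) (hN₁ : 0 < N₁) (hN : N₁ ≤ N₂)
    (hsum : ∑ i, a i = N₂ ^ 2) (hpow : ∑ i, (p ^ k i) ^ 2 * a i ≤ N₁ * N₂) :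
    ∑ i, a i / k i ≤
      9 * Real.log (1 / p) * (N₂ ^ 2 / Real.log (Real.exp 1 * N₂ / N₁)) := by
  have hN₂ : 0 < N₂ := hN₁.trans_le hN
  set r := N₂ / N₁ with hr
  have hr1 : 1 ≤ r := by rwa [hr, one_le_div hN₁]
  have hr0 : 0 < r := one_pos.trans_le hr1
  have hlr : 0 ≤ Real.log r := Real.log_nonneg hr1
  have hlog : Real.log (Real.exp 1 * N₂ / N₁) = 1 + Real.log r := by
    rw [mul_div_assoc, Real.log_mul (Real.exp_pos 1).ne' hr0.ne', Real.log_exp]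
  have hL : 0.69 ≤ Real.log (1 / p) := by
    refine le_trans (by linarith [Real.log_two_gt_d9]) (Real.log_le_log two_pos ?_)
    rw [le_div_iff₀ hp]; linarith
  -- From `log √r ≤ √r - 1`.
  have hsr : (√r)⁻¹ ≤ 2 / (1 + Real.log r) := by
    rw [inv_le_comm₀ (by positivity) (by positivity), inv_div]
    have := Real.log_le_sub_one_of_pos (Real.sqrt_pos.2 hr0)
    rw [Real.log_sqrt hr0.le] at this
    linarith
  calc ∑ i, a i / k i
      ≤ ∑ i, (a i * ((1 + 4 * Real.log (1 / p)) / (1 + Real.log r)) +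
          √r * ((p ^ k i) ^ 2 * a i)) := by
        refine Finset.sum_le_sum fun i _ => ?_
        rw [div_eq_mul_inv]
        refine (mul_le_mul_of_nonneg_left (inv_le_add_pow_mul_sqrt hp hp2 hr1) (ha i)).trans_eq ?_
        ring
    _ ≤ N₂ ^ 2 * ((1 + 4 * Real.log (1 / p)) / (1 + Real.log r)) + √r * (N₁ * N₂) := by
        rw [Finset.sum_add_distrib, ← Finset.sum_mul, ← Finset.mul_sum, hsum]
        gcongr
    _ = N₂ ^ 2 * ((1 + 4 * Real.log (1 / p)) / (1 + Real.log r)) + N₂ ^ 2 * (√r)⁻¹ := by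
        have h1 : N₁ * r = N₂ := by rw [hr]; field_simp
        have h2 := Real.mul_self_sqrt hr0.le
        have h3 : √r ≠ 0 := (Real.sqrt_pos.2 hr0).ne'
        congr 1
        rw [eq_mul_inv_iff_mul_eq₀ h3, ← h1]
        linear_combination (N₁ ^ 2 * r) * h2
    _ ≤ N₂ ^ 2 * ((1 + 4 * Real.log (1 / p)) / (1 + Real.log r)) +
          N₂ ^ 2 * (2 / (1 + Real.log r)) := by gcongr
    _ = (3 + 4 * Real.log (1 / p)) * (N₂ ^ 2 / (1 + Real.log r)) := by ring
    -- `3 + 4 L ≤ 9 L` because `L = log (1/p) ≥ 0.69`.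
    _ ≤ _ := by
        rw [hlog]
        gcongr
        linarith

/-! ### Spectral form of the influences and the variance -/

section Product

variable {X ι : Type*} [Fintype X] [Fintype ι] [DecidableEq X] [DecidableEq ι]
  {w : X → ℝ} {φ : ι → X → ℝ}

theorem IsWeightedBasis.sum_div_level_le (h : IsWeightedBasis w φ) {o : ι}
    (ho : ∀ x, φ o x = 1) {p : ℝ} (hp : 0 < p) (hp2 : p ≤ 1 / 2) (hw : ∀ x, p ≤ w x)
    {n : ℕ} (c : (Fin n → ι) → ℂ) (g : (Fin n → X) → ℂ)
    (hg : g = synth (fun α : Fin n → ι => tensor fun i => φ (α i)) c) {N₁ N₂ : ℝ}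
    (hN₁ : N₁ = ∑ x, tensor (fun _ => w) x * ‖g x‖)
    (hN₂ : N₂ = √(∑ x, tensor (fun _ => w) x * ‖g x‖ ^ 2)) :
    ∑ α, ‖c α‖ ^ 2 / level o α ≤
      9 * Real.log (1 / p) * (N₂ ^ 2 / Real.log (Real.exp 1 * N₂ / N₁)) := by
  have hW (x : Fin n → X) : 0 < tensor (fun _ => w) x :=
    Finset.prod_pos fun i _ => hp.trans_le (hw _)
  have hN₂0 : 0 ≤ N₂ := hN₂ ▸ Real.sqrt_nonneg _
  have hN₁0 : 0 ≤ N₁ := hN₁ ▸ Finset.sum_nonneg fun x _ => mul_nonneg (hW x).le (norm_nonneg _)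
  have hN₂s : N₂ ^ 2 = ∑ x, tensor (fun _ => w) x * ‖g x‖ ^ 2 := by
    rw [hN₂, Real.sq_sqrt (Finset.sum_nonneg fun x _ => mul_nonneg (hW x).le (by positivity))]
  have hsum : ∑ α, ‖c α‖ ^ 2 = N₂ ^ 2 := by
    rw [hN₂s, hg, h.tensorPower.sum_norm_sq_synth]
  have hone : ∑ x : Fin n → X, tensor (fun _ => w) x = 1 :=
    h.tensorPower.sum_weight (o := fun _ => o) fun x => by simp [tensor, ho]
  have hle : N₁ ≤ N₂ := by
    refine le_of_sq_le_sq ?_ hN₂0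
    calc N₁ ^ 2 = (∑ x, √(tensor (fun _ => w) x) * (√(tensor (fun _ => w) x) * ‖g x‖)) ^ 2 := by
          simp only [hN₁, ← mul_assoc, Real.mul_self_sqrt (hW _).le]
      _ ≤ _ := Finset.sum_mul_sq_le_sq_mul_sq _ _ _
      _ = N₂ ^ 2 := by simp only [mul_pow, Real.sq_sqrt (hW _).le, hone, hN₂s, one_mul]
  -- If `N₁ = 0` then `g` and all its coefficients vanish, and both sides are `0`.
  rcases hN₁0.eq_or_lt with h0 | h0
  · have hgz : ∀ x, g x = 0 := fun x => by
      have := (Finset.sum_eq_zero_iff_of_nonneg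
        fun x _ => mul_nonneg (hW x).le (norm_nonneg (g x))).1 (hN₁.symm.trans h0.symm) x
          (Finset.mem_univ x)
      simpa [(hW x).ne'] using this
    have hz : ∑ α, ‖c α‖ ^ 2 = 0 := by rw [hsum, hN₂s]; simp [hgz]
    have hc : ∀ α, ‖c α‖ ^ 2 = 0 := fun α =>
      (Finset.sum_eq_zero_iff_of_nonneg fun _ _ => by positivity).1 hz α (Finset.mem_univ α)
    rw [← hsum]
    simp [hc]
  · refine sum_div_le_of_sum_pow_mul_le (fun _ => by positivity) _ hp hp2 h0 hle hsum ?_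
    refine le_of_sq_le_sq ?_ (by positivity)
    simp only [← damping_eq_pow_level]
    refine (h.sum_damping_sq_le ho hp hp2 hw c g hg).trans_eq ?_
    rw [← hN₁, ← hN₂s]
    ring

theorem IsWeightedBasis.sub_sum_update_synth (h : IsWeightedBasis w φ) {o : ι}
    (ho : ∀ x, φ o x = 1) {n : ℕ} (c : (Fin n → ι) → ℂ) (i : Fin n) (x : Fin n → X) :
    synth (fun α : Fin n → ι => tensor fun i => φ (α i)) c x -
        ∑ ξ, (w ξ : ℂ) * synth (fun α : Fin n → ι => tensor fun i => φ (α i)) c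
          (Function.update x i ξ) =
      synth (fun α : Fin n → ι => tensor fun i => φ (α i))
        (fun α => if α i = o then 0 else c α) x := by
  have hmean (a : ι) : ∑ ξ, w ξ * φ a ξ = if a = o then 1 else 0 := by
    simpa [ho] using h.orthonormal a o
  have hupd (α : Fin n → ι) (ξ : X) : tensor (fun j => φ (α j)) (Function.update x i ξ) =
      φ (α i) ξ * ∏ j ∈ Finset.univ.erase i, φ (α j) (x j) := by
    rw [tensor, ← Finset.mul_prod_erase _ _ (Finset.mem_univ i), Function.update_self]
    congr 1
    refine Finset.prod_congr rfl fun j hj => ?_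
    rw [Function.update_of_ne (Finset.ne_of_mem_erase hj)]
  have hint (α : Fin n → ι) :
      ∑ ξ, w ξ * tensor (fun j => φ (α j)) (Function.update x i ξ) =
        if α i = o then tensor (fun j => φ (α j)) x else 0 := by
    simp only [hupd, ← mul_assoc, ← Finset.sum_mul, hmean]
    split_ifs with hα
    · rw [tensor, ← Finset.mul_prod_erase _ _ (Finset.mem_univ i), hα, ho]
    · simp
  have hswap : ∑ ξ, (w ξ : ℂ) * synth (fun α : Fin n → ι => tensor fun i => φ (α i)) c
      (Function.update x i ξ) =
      ∑ α, c α * ((∑ ξ, w ξ * tensor (fun j => φ (α j)) (Function.update x i ξ) : ℝ) : ℂ) := by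
    simp only [synth, Complex.ofReal_sum, Finset.mul_sum]
    rw [Finset.sum_comm]
    refine Finset.sum_congr rfl fun α _ => Finset.sum_congr rfl fun ξ _ => ?_
    push_cast
    ring
  rw [hswap, synth, synth, ← Finset.sum_sub_distrib]
  refine Finset.sum_congr rfl fun α _ => ?_
  rw [hint]
  split_ifs <;> simp

theorem IsWeightedBasis.sum_norm_sq_sub_mean_synth (h : IsWeightedBasis w φ) {o : ι}
    (ho : ∀ x, φ o x = 1) (c : ι → ℂ) :
    ∑ x, w x * ‖synth φ c x - ∑ y, (w y : ℂ) * synth φ c y‖ ^ 2 =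
      ∑ a, if a = o then 0 else ‖c a‖ ^ 2 := by
  have e (x : X) : synth φ c x - ∑ y, (w y : ℂ) * synth φ c y =
      synth φ (fun a => if a = o then 0 else c a) x := by
    have : c o = ∑ a, if a = o then c a * (φ a x : ℂ) else 0 := by simp [ho]
    rw [h.sum_synth ho, this, synth, synth, ← Finset.sum_sub_distrib]
    refine Finset.sum_congr rfl fun a _ => ?_
    split_ifs <;> simp
  simp only [e, h.sum_norm_sq_synth]
  refine Finset.sum_congr rfl fun a _ => ?_
  split_ifs <;> simp

end Product

/-- A nonconstant mode `α` survives in exactly `level o α` of the influences, so dividing by the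
level counts it once. -/
theorem sum_div_level {κ ι : Type*} [Fintype κ] [DecidableEq ι] (o : ι) (α : κ → ι) (c : ℂ) :
    ∑ i, ‖if α i = o then 0 else c‖ ^ 2 / (level o α : ℝ) =
      if α = fun _ => o then 0 else ‖c‖ ^ 2 := by
  have e (i : κ) : ‖if α i = o then 0 else c‖ ^ 2 / (level o α : ℝ) =
      if α i ≠ o then ‖c‖ ^ 2 / (level o α : ℝ) else 0 := by
    by_cases hi : α i = o <;> simp [hi]
  simp only [e, ← Finset.sum_filter, Finset.sum_const, nsmul_eq_mul]
  change (level o α : ℝ) * _ = _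
  split_ifs with hα
  · simp [hα, level]
  · obtain ⟨i, hi⟩ : ∃ i, α i ≠ o := by
      by_contra! hcon
      exact hα (funext hcon)
    have : (level o α : ℝ) ≠ 0 := by
      simp only [level, ne_eq, Nat.cast_eq_zero, Finset.card_eq_zero]
      exact Finset.ne_empty_of_mem (a := i) (by simp [hi])
    field_simp

/-! ### Passage from weighted sums to integrals -/

theorem pMin_le {Ω : Type*} [Finite Ω] [MeasurableSpace Ω] (μ : Measure Ω) (x : Ω) :
    pMin μ ≤ μ.real {x} :=
  ciInf_le (Set.finite_range _).bddBelow x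

section Integral

variable {Ω : Type*} [Fintype Ω] [MeasurableSpace Ω] [DiscreteMeasurableSpace Ω]
  (μ : Measure Ω) [IsProbabilityMeasure μ]

theorem integral_power {E : Type*} [NormedAddCommGroup E] [NormedSpace ℝ E] [CompleteSpace E]
    {n : ℕ} (F : (Fin n → Ω) → E) :
    ∫ x, F x ∂(power μ n) = ∑ x, tensor (fun _ => fun a => μ.real {a}) x • F x := by
  rw [integral_fintype Integrable.of_finite]
  refine Finset.sum_congr rfl fun x _ => ?_
  congr 1
  simp [power, tensor, Measure.real, Measure.pi_singleton, ENNReal.toReal_prod]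

theorem complexVariance_le (hp : 0 < pMin μ) (hp2 : pMin μ ≤ 1 / 2) {n : ℕ}
    (f : (Fin n → Ω) → ℂ) :
    complexVariance (power μ n) f ≤
      9 * Real.log (1 / pMin μ) *
        ∑ i : Fin n, lqNorm (power μ n) 2 (delta μ i f) ^ 2 /
          Real.log (Real.exp 1 * lqNorm (power μ n) 2 (delta μ i f) /
            lqNorm (power μ n) 1 (delta μ i f)) := by
  classical
  set w : Ω → ℝ := fun a => μ.real {a} with hwdef
  have hw : ∀ x, pMin μ ≤ w x := pMin_le μ
  have hsum : ∑ x, w x = 1 := by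
    simp only [hwdef, sum_measureReal_singleton, Finset.coe_univ, probReal_univ]
  obtain ⟨o⟩ : Nonempty Ω := nonempty_of_isProbabilityMeasure μ
  obtain ⟨φ, h, ho⟩ := exists_isWeightedBasis (fun x => hp.trans_le (hw x)) hsum o
  have hoT (x : Fin n → Ω) : tensor (fun _ => φ o) x = 1 := by simp [tensor, ho]
  obtain ⟨c, hc⟩ := (h.tensorPower (κ := Fin n)).exists_synth f
  have hvar : complexVariance (power μ n) f =
      ∑ α : Fin n → Ω, if α = fun _ => o then 0 else ‖c α‖ ^ 2 := by
    rw [← h.tensorPower.sum_norm_sq_sub_mean_synth (o := fun _ => o) hoT c, ← hc,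
      complexVariance, integral_power, integral_power]
    simp [hwdef]
  have hdelta (i : Fin n) : delta μ i f = synth (fun α : Fin n → Ω => tensor fun i => φ (α i))
      (fun α => if α i = o then 0 else c α) := by
    funext x
    rw [← h.sub_sum_update_synth ho c i x, ← hc, delta,
      integral_fintype Integrable.of_finite]
    simp [hwdef]
  rw [hvar, Finset.mul_sum]
  simp only [← sum_div_level]
  rw [Finset.sum_comm]
  refine Finset.sum_le_sum fun i _ => ?_
  refine h.sum_div_level_le ho hp hp2 hw _ (delta μ i f) (hdelta i) ?_ ?_
  · simp [lqNorm, integral_power, hwdef]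
  · rw [lqNorm, integral_power, Real.sqrt_eq_rpow]
    simp [hwdef]

end Integral

end Influence

theorem theorem1p3 :
    ∃ K : ℝ, 0 < K ∧
      ∀ (Ω : Type*) [Finite Ω] [MeasurableSpace Ω] [DiscreteMeasurableSpace Ω]
        (μ : Measure Ω) [IsProbabilityMeasure μ], 0 < Influence.pMin μ →
      ∀ (n : ℕ) (f : (Fin n → Ω) → ℂ),
        Influence.complexVariance (Influence.power μ n) f ≤
          K * Real.log (1 / Influence.pMin μ) *
            ∑ i : Fin n,
              Influence.lqNorm (Influence.power μ n) 2 (Influence.delta μ i f) ^ 2 /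
                Real.log (Real.exp 1 *
                  Influence.lqNorm (Influence.power μ n) 2 (Influence.delta μ i f) /
                  Influence.lqNorm (Influence.power μ n) 1 (Influence.delta μ i f)) := by
  refine ⟨9, by norm_num, fun Ω _ _ _ μ _ hp n f => ?_⟩
  have := Fintype.ofFinite Ω
  rcases le_or_gt (Influence.pMin μ) (1 / 2) with hp2 | hp2
  · exact Influence.complexVariance_le μ hp hp2 f
  -- Two points of mass above `1/2` cannot coexist, so `Ω` is a single point; the variance and `log
  -- (1 / pMin μ)` are both `0`.
  · have hsub : Subsingleton Ω := by
      refine ⟨fun x y => by_contra fun hxy => ?_⟩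
      have h1 := Influence.pMin_le μ x
      have h2 := Influence.pMin_le μ y
      have h3 : μ.real ({x} ∪ {y}) = μ.real {x} + μ.real {y} :=
        measureReal_union (Set.disjoint_singleton.2 hxy) (measurableSet_singleton y)
      have h4 : μ.real ({x} ∪ {y}) ≤ 1 := measureReal_le_one
      linarith
    obtain ⟨o⟩ : Nonempty Ω := nonempty_of_isProbabilityMeasure μ
    have hone : Influence.pMin μ = 1 := by
      have hj (j : Ω) : μ.real {j} = 1 := by
        rw [Set.eq_univ_of_forall fun x => Set.mem_singleton_iff.2 (Subsingleton.elim x j)]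
        simp
      have : Nonempty Ω := ⟨o⟩
      simp only [Influence.pMin, hj, ciInf_const]
    have hconst (x : Fin n → Ω) : f x = f fun _ => o := congrArg f (Subsingleton.elim _ _)
    have hvar : Influence.complexVariance (Influence.power μ n) f = 0 := by
      simp only [Influence.complexVariance, hconst]
      simp
    simp [hvar, hone]
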